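/- Let $\mathcal X\subset\mathbb R^d$ be a finite set, $\mathcal Y\subset\mathbb R$ a set with $|\mathcal Y|=2$, and $P$ an unknown joint distribution of $(X,Y)$ on $\mathcal X\times\mathcal Y$ under which every $x\in\mathcal X$ has positive probability. A (randomized, adaptive) learner makes $N$ queries: at each step it chooses, possibly at random and depending on all earlier queries and answers, a point $x\in\mathcal X$ and receives a fresh independent sample from the conditional law $P(\,\cdot\mid X=x)$ of the label. After $N$ queries it returns $\widehat\beta\in\mathbb R^d$, possibly using further randomness. The learner solves the distributional active $\ell_1$ regression problem on $P$ with accuracy $\varepsilon$ and failure probability $\delta$ if, with probability at least $1-\delta$, $$\mathbb E_{(X,Y)\sim P}\bigl[|X^\top\widehat\beta-Y|\bigr]\le(1+\varepsilon)\inf_{\beta\in\mathbb R^d}\mathbb E_{(X,Y)\sim P}\bigl[|X^\top\beta-Y|\bigr].$$ Theorem. There is an absolute constant $c>0$ such that for all integers $d\ge 2$ and all reals $0<\varepsilon<\frac1{10}$ and $0<\delta<\frac14$ there exist a finite set $\mathcal X\subset\mathbb R^d$, a set $\mathcal Y\subset\mathbb R$ with $|\mathcal Y|=2$, and a probability distribution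 $q$ on $\mathcal X$ giving every point positive probability, with the following property: every learner (which may depend on $d,\varepsilon,\delta,\mathcal X,\mathcal Y,q$) that makes $N$ queries and solves the problem with accuracy $\varepsilon$ and failure probability $\delta$ on every distribution $P$ on $\mathcal X\times\mathcal Y$ whose marginal on $\mathcal X$ is $q$ must satisfy $$N\ \ge\ c\left(\frac d{\varepsilon^2}+\frac1{\varepsilon^2}\log\frac1\delta+d\log\frac1\delta\right).$$ -/

import Mathlib

noncomputable section

/-- An instance of distributional active regression over a finite set `𝒳 ⊂ ℝ^d` of inputs and a
finite set `𝒴 ⊂ ℝ` of labels: a joint distribution on `𝒳 × 𝒴`. Every input has positive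
probability, so that the conditional law of the label given any input is defined. -/
structure RegressionInstance {d : ℕ} (𝒳 : Finset (Fin d → ℝ)) (𝒴 : Finset ℝ) where
  /-- the joint distribution of `(X, Y)` -/
  joint : PMF (𝒳 × 𝒴)
  /-- every input has positive probability -/
  marginal_ne_zero : ∀ x : 𝒳, joint.map Prod.fst x ≠ 0

namespace RegressionInstance

variable {d : ℕ} {𝒳 : Finset (Fin d → ℝ)} {𝒴 : Finset ℝ}

/-- The distribution of the input `X`. -/
def marginal (P : RegressionInstance 𝒳 𝒴) : PMF 𝒳 := P.joint.map Prod.fst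

theorem exists_fst_eq_mem_support (P : RegressionInstance 𝒳 𝒴) (x : 𝒳) :
    ∃ z ∈ {z : 𝒳 × 𝒴 | z.1 = x}, z ∈ P.joint.support := by
  obtain ⟨z, hz, hx⟩ :=
    (PMF.mem_support_map_iff Prod.fst P.joint x).1
      ((PMF.mem_support_iff _ _).2 (P.marginal_ne_zero x))
  exact ⟨z, hx, hz⟩

/-- The conditional law of the label `Y` given `X = x`. -/
def condLabel (P : RegressionInstance 𝒳 𝒴) (x : 𝒳) : PMF 𝒴 :=
  (P.joint.filter {z | z.1 = x} (P.exists_fst_eq_mem_support x)).map Prod.snd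

/-- The expected absolute loss `E |Xᵀ β - Y|`. -/
def loss (P : RegressionInstance 𝒳 𝒴) (β : Fin d → ℝ) : ℝ :=
  ∑ z : 𝒳 × 𝒴, (P.joint z).toReal * |(z.1 : Fin d → ℝ) ⬝ᵥ β - (z.2 : ℝ)|

/-- The parameters `β` whose loss is at most `1 + ε` times the optimal loss. -/
def approxMinimizers (P : RegressionInstance 𝒳 𝒴) (ε : ℝ) : Set (Fin d → ℝ) :=
  {β | P.loss β ≤ (1 + ε) * ⨅ β' : Fin d → ℝ, P.loss β'}

end RegressionInstance

/-- A randomized adaptive learner. Given the transcript of the queries made so far and the labels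
received (most recent first), `query` is the law of the next input to be queried, and `output` is
the law of the estimate returned if the learner stops with that transcript. -/
structure ActiveLearner {d : ℕ} (𝒳 : Finset (Fin d → ℝ)) (𝒴 : Finset ℝ) where
  /-- the law of the next query given the transcript -/
  query : List (𝒳 × 𝒴) → PMF 𝒳
  /-- the law of the returned estimate given the final transcript -/
  output : List (𝒳 × 𝒴) → MeasureTheory.ProbabilityMeasure (Fin d → ℝ)

namespace ActiveLearner

variable {d : ℕ} {𝒳 : Finset (Fin d → ℝ)} {𝒴 : Finset ℝ}

/-- The law of the transcript after `N` queries: each query is answered by a fresh sample from the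
conditional law of the label given the queried input. -/
def transcript (L : ActiveLearner 𝒳 𝒴) (P : RegressionInstance 𝒳 𝒴) : ℕ → PMF (List (𝒳 × 𝒴))
  | 0 => PMF.pure []
  | N + 1 => (transcript L P N).bind fun h =>
      (L.query h).bind fun x => (P.condLabel x).map fun y => (x, y) :: h

/-- The probability that the estimate returned after `N` queries lies in `S`. -/
def outputProb (L : ActiveLearner 𝒳 𝒴) (P : RegressionInstance 𝒳 𝒴) (N : ℕ)
    (S : Set (Fin d → ℝ)) : ENNReal :=
  ∑' h : List (𝒳 × 𝒴),
    L.transcript P N h * (L.output h : MeasureTheory.Measure (Fin d → ℝ)) S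

/-- With `N` samples from the instance `P`, the learner returns a `(1 + ε)`-approximate minimizer
with probability at least `1 - δ`. -/
def Solves (L : ActiveLearner 𝒳 𝒴) (P : RegressionInstance 𝒳 𝒴) (N : ℕ) (ε δ : ℝ) : Prop :=
  ENNReal.ofReal (1 - δ) ≤ L.outputProb P N (P.approxMinimizers ε)

end ActiveLearner

end

/-! Take the standard basis vectors, uniformly distributed, with labels in `{0, 1}`. The loss is
then an average of separate one-coin losses. At a coordinate whose label is `1` with probability
`p`, the best cost is `min p (1 - p)`, while an estimate on the wrong side of `1 / 2` costs at least
`1 / 2`. A near-minimizer must therefore decide, at all or most coordinates, which label is more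
likely (`sum_misclassifies_le`). Regression becomes testing, and each of the three terms is a
testing lower bound.

For `log (1 / δ) / ε ^ 2`: one coin has bias `1 / 2 ± ε` and all other labels are deterministic, so
the relative error concerns that coin alone. For `d * log (1 / δ)`: all labels are `0`, except that
one hidden coordinate may carry a coin of bias `3 / 4`. Some coordinate is queried at most `N / d`
times on average. For `d / ε ^ 2`: an Assouad argument over all sign vectors, with biases `1 / 2 ± 4
* ε`.

Indistinguishability is measured by the Bhattacharyya affinity of the transcript laws. It suits
adaptive learners because the query probabilities are common to both instances, so one more query
changes the affinity only through the label affinity at the queried point. It is bounded below by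
`pow_le_affinity`, `rpow_expectedQueries_le_affinity` and `one_sub_affinity_le`, and turned into
error probabilities by `affinity_le_sqrt_add_sqrt` and `four_mul_affinity_le`. -/

noncomputable section

open MeasureTheory

/-! ### Transcript laws as finite sums -/

/-- Prepending an element to a list, as an embedding. -/
def consEmbedding (α : Type*) : α × List α ↪ List α where
  toFun z := z.1 :: z.2
  inj' _ _ h := Prod.ext (List.cons.inj h).1 (List.cons.inj h).2

theorem consEmbedding_apply {α : Type*} (z : α × List α) : consEmbedding α z = z.1 :: z.2 :=
  rfl

/-- The lists of length `n` over a finite type. -/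
def listsOfLength (α : Type*) [Fintype α] : ℕ → Finset (List α)
  | 0 => {[]}
  | n + 1 => ((Finset.univ : Finset α) ×ˢ listsOfLength α n).map (consEmbedding α)

theorem sum_listsOfLength_succ {α : Type*} [Fintype α] (n : ℕ) (f : List α → ℝ) :
    ∑ h ∈ listsOfLength α (n + 1), f h = ∑ h ∈ listsOfLength α n, ∑ z, f (z :: h) := by
  rw [listsOfLength, Finset.sum_map, Finset.sum_product_right]
  rfl

theorem cons_mem_listsOfLength {α : Type*} [Fintype α] {n : ℕ} {z : α} {h : List α} :
    z :: h ∈ listsOfLength α (n + 1) ↔ h ∈ listsOfLength α n := by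
  simp [listsOfLength, consEmbedding_apply]

theorem length_of_mem_listsOfLength {α : Type*} [Fintype α] {n : ℕ} {h : List α}
    (hh : h ∈ listsOfLength α n) : h.length = n := by
  induction n generalizing h with
  | zero => simpa [listsOfLength] using hh
  | succ n ih =>
    simp only [listsOfLength, Finset.mem_map, Finset.mem_product, Finset.mem_univ, true_and] at hh
    obtain ⟨z, hz, rfl⟩ := hh
    simp [consEmbedding_apply, ih hz]

theorem PMF.sum_toReal_eq_one {α : Type*} [Fintype α] (p : PMF α) : ∑ a, (p a).toReal = 1 := by
  rw [← ENNReal.toReal_sum fun a _ => p.apply_ne_top a, ← tsum_fintype (L := .unconditional _),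
    p.tsum_coe, ENNReal.toReal_one]

namespace ActiveLearner

variable {d : ℕ} {𝒳 : Finset (Fin d → ℝ)} {𝒴 : Finset ℝ}

theorem transcript_succ_cons (L : ActiveLearner 𝒳 𝒴) (P : RegressionInstance 𝒳 𝒴) (n : ℕ)
    (z : 𝒳 × 𝒴) (h : List (𝒳 × 𝒴)) :
    L.transcript P (n + 1) (z :: h) =
      L.transcript P n h * (L.query h z.1 * P.condLabel z.1 z.2) := by
  obtain ⟨x, y⟩ := z
  rw [transcript, PMF.bind_apply, tsum_eq_single h]
  · congr 1
    rw [PMF.bind_apply, tsum_eq_single x]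
    · congr 1
      rw [PMF.map_apply, tsum_eq_single y]
      · simp
      · intro y' hy
        rw [if_neg]
        simpa using hy.symm
    · intro x' hx
      rw [PMF.map_apply, ENNReal.tsum_eq_zero.2, mul_zero]
      intro y'
      rw [if_neg]
      simp [hx.symm]
  · intro h' hh
    rw [PMF.bind_apply, ENNReal.tsum_eq_zero.2, mul_zero]
    intro x'
    rw [PMF.map_apply, ENNReal.tsum_eq_zero.2, mul_zero]
    intro y'
    rw [if_neg]
    simp [hh.symm]

theorem transcript_eq_zero (L : ActiveLearner 𝒳 𝒴) (P : RegressionInstance 𝒳 𝒴) (n : ℕ)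
    (h : List (𝒳 × 𝒴)) (hh : h ∉ listsOfLength (𝒳 × 𝒴) n) : L.transcript P n h = 0 := by
  induction n generalizing h with
  | zero => simpa [transcript, listsOfLength] using hh
  | succ n ih =>
    cases h with
    | nil =>
      rw [← PMF.toOuterMeasure_apply_singleton, transcript]
      rw [PMF.toOuterMeasure_apply_singleton, PMF.apply_eq_zero_iff]
      simp
    | cons z t =>
      rw [transcript_succ_cons, ih t (mt cons_mem_listsOfLength.2 hh), zero_mul]

/-- The probability of a transcript, as a real number. -/
def weight (L : ActiveLearner 𝒳 𝒴) (P : RegressionInstance 𝒳 𝒴) (n : ℕ)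
    (h : List (𝒳 × 𝒴)) : ℝ :=
  (L.transcript P n h).toReal

theorem weight_nonneg (L : ActiveLearner 𝒳 𝒴) (P : RegressionInstance 𝒳 𝒴) (n : ℕ)
    (h : List (𝒳 × 𝒴)) : 0 ≤ L.weight P n h :=
  ENNReal.toReal_nonneg

theorem weight_zero_nil (L : ActiveLearner 𝒳 𝒴) (P : RegressionInstance 𝒳 𝒴) :
    L.weight P 0 [] = 1 := by
  simp [weight, transcript]

theorem weight_succ_cons (L : ActiveLearner 𝒳 𝒴) (P : RegressionInstance 𝒳 𝒴) (n : ℕ)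
    (z : 𝒳 × 𝒴) (h : List (𝒳 × 𝒴)) :
    L.weight P (n + 1) (z :: h) =
      L.weight P n h * ((L.query h z.1).toReal * (P.condLabel z.1 z.2).toReal) := by
  simp [weight, transcript_succ_cons]

theorem sum_weight_eq_one (L : ActiveLearner 𝒳 𝒴) (P : RegressionInstance 𝒳 𝒴) (n : ℕ) :
    ∑ h ∈ listsOfLength (𝒳 × 𝒴) n, L.weight P n h = 1 := by
  simp only [weight]
  rw [← ENNReal.toReal_sum fun a _ => PMF.apply_ne_top _ a,
    ← tsum_eq_sum (L := .unconditional _) (fun h hh => L.transcript_eq_zero P n h hh),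
    PMF.tsum_coe, ENNReal.toReal_one]

/-- The law of the returned estimate. -/
def outputLaw (L : ActiveLearner 𝒳 𝒴) (P : RegressionInstance 𝒳 𝒴) (n : ℕ) :
    Measure (Fin d → ℝ) :=
  Measure.sum fun h => L.transcript P n h • (L.output h : Measure (Fin d → ℝ))

theorem outputLaw_apply (L : ActiveLearner 𝒳 𝒴) (P : RegressionInstance 𝒳 𝒴) (n : ℕ)
    {S : Set (Fin d → ℝ)} (hS : MeasurableSet S) :
    L.outputLaw P n S = L.outputProb P n S := by
  simp [outputLaw, outputProb, Measure.sum_apply _ hS]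

instance (L : ActiveLearner 𝒳 𝒴) (P : RegressionInstance 𝒳 𝒴) (n : ℕ) :
    IsProbabilityMeasure (L.outputLaw P n) :=
  ⟨by simp [outputLaw_apply, outputProb, PMF.tsum_coe]⟩

theorem outputLaw_real_apply (L : ActiveLearner 𝒳 𝒴) (P : RegressionInstance 𝒳 𝒴) (n : ℕ)
    {S : Set (Fin d → ℝ)} (hS : MeasurableSet S) :
    (L.outputLaw P n).real S = ∑ h ∈ listsOfLength (𝒳 × 𝒴) n,
      L.weight P n h * (L.output h : Measure (Fin d → ℝ)).real S := by
  rw [Measure.real, outputLaw_apply _ _ _ hS, outputProb,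
    tsum_eq_sum (s := listsOfLength (𝒳 × 𝒴) n)
      (fun h hh => by rw [L.transcript_eq_zero P n h hh, zero_mul]),
    ENNReal.toReal_sum fun h _ => ENNReal.mul_ne_top (PMF.apply_ne_top _ _) (measure_ne_top _ _)]
  simp [weight, Measure.real]

/-! ### Affinity of transcripts and expected query counts -/

/-- The Bhattacharyya affinity of the transcripts under two instances. -/
def affinity (L : ActiveLearner 𝒳 𝒴) (P Q : RegressionInstance 𝒳 𝒴) (n : ℕ) : ℝ :=
  ∑ h ∈ listsOfLength (𝒳 × 𝒴) n, √(L.weight P n h * L.weight Q n h)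

end ActiveLearner

/-- The Bhattacharyya affinity of the label laws at `x` under two instances. -/
def RegressionInstance.labelAffinity {d : ℕ} {𝒳 : Finset (Fin d → ℝ)} {𝒴 : Finset ℝ}
    (P Q : RegressionInstance 𝒳 𝒴) (x : 𝒳) : ℝ :=
  ∑ y, √((P.condLabel x y).toReal * (Q.condLabel x y).toReal)

namespace ActiveLearner

variable {d : ℕ} {𝒳 : Finset (Fin d → ℝ)} {𝒴 : Finset ℝ}

theorem affinity_zero (L : ActiveLearner 𝒳 𝒴) (P Q : RegressionInstance 𝒳 𝒴) :
    L.affinity P Q 0 = 1 := by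
  simp [affinity, listsOfLength, weight_zero_nil]

theorem affinity_succ (L : ActiveLearner 𝒳 𝒴) (P Q : RegressionInstance 𝒳 𝒴) (n : ℕ) :
    L.affinity P Q (n + 1) = ∑ h ∈ listsOfLength (𝒳 × 𝒴) n,
      √(L.weight P n h * L.weight Q n h) * ∑ x, (L.query h x).toReal * P.labelAffinity Q x := by
  rw [affinity, sum_listsOfLength_succ]
  refine Finset.sum_congr rfl fun h _ => ?_
  rw [Fintype.sum_prod_type, Finset.mul_sum]
  refine Finset.sum_congr rfl fun x _ => ?_
  rw [RegressionInstance.labelAffinity, Finset.mul_sum, Finset.mul_sum]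
  refine Finset.sum_congr rfl fun y _ => ?_
  rw [weight_succ_cons, weight_succ_cons]
  have hq : 0 ≤ (L.query h x).toReal := ENNReal.toReal_nonneg
  rw [← Real.sqrt_sq hq, ← Real.sqrt_mul (sq_nonneg _), ← Real.sqrt_mul
    (mul_nonneg (weight_nonneg ..) (weight_nonneg ..)), Real.sqrt_sq hq]
  congr 1
  ring

/-- Given the past, one more query multiplies the affinity by an average of label affinities,
weighted by the learner's query law; that average is at least `b`. -/
theorem pow_le_affinity (L : ActiveLearner 𝒳 𝒴) (P Q : RegressionInstance 𝒳 𝒴) {b : ℝ}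
    (hb : 0 ≤ b) (h : ∀ x, b ≤ P.labelAffinity Q x) (n : ℕ) : b ^ n ≤ L.affinity P Q n := by
  induction n with
  | zero => simp [affinity_zero]
  | succ n ih =>
    rw [affinity_succ, pow_succ]
    refine (mul_le_mul_of_nonneg_right ih hb).trans ?_
    rw [affinity, Finset.sum_mul]
    gcongr with t _
    calc b = ∑ x, (L.query t x).toReal * b := by
          rw [← Finset.sum_mul, PMF.sum_toReal_eq_one, one_mul]
      _ ≤ _ := by gcongr with x; exact h x

/-- The number of queries of `x` in a transcript. -/
def queryCount (x : 𝒳) : List (𝒳 × 𝒴) → ℕ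
  | [] => 0
  | z :: h => open Classical in (if z.1 = x then 1 else 0) + queryCount x h

/-- The expected number of queries of `x`. -/
def expectedQueries (L : ActiveLearner 𝒳 𝒴) (P : RegressionInstance 𝒳 𝒴) (n : ℕ) (x : 𝒳) : ℝ :=
  ∑ h ∈ listsOfLength (𝒳 × 𝒴) n, L.weight P n h * queryCount x h

theorem sum_queryCount (h : List (𝒳 × 𝒴)) : ∑ x, queryCount x h = h.length := by
  induction h with
  | nil => simp [queryCount]
  | cons z h ih => classical
    simp only [queryCount, Finset.sum_add_distrib, ih, List.length_cons]
    rw [Finset.sum_ite_eq, if_pos (Finset.mem_univ _), add_comm]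

theorem sum_expectedQueries (L : ActiveLearner 𝒳 𝒴) (P : RegressionInstance 𝒳 𝒴) (n : ℕ) :
    ∑ x, L.expectedQueries P n x = n := by
  simp only [expectedQueries]
  rw [Finset.sum_comm]
  calc _ = ∑ h ∈ listsOfLength (𝒳 × 𝒴) n, L.weight P n h * n := by
        refine Finset.sum_congr rfl fun h hh => ?_
        rw [← Finset.mul_sum, ← Nat.cast_sum, sum_queryCount, length_of_mem_listsOfLength hh]
    _ = n := by rw [← Finset.sum_mul, sum_weight_eq_one, one_mul]

theorem expectedQueries_succ (L : ActiveLearner 𝒳 𝒴) (P : RegressionInstance 𝒳 𝒴) (n : ℕ)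
    (x : 𝒳) :
    L.expectedQueries P (n + 1) x = L.expectedQueries P n x +
      ∑ h ∈ listsOfLength (𝒳 × 𝒴) n, L.weight P n h * (L.query h x).toReal := by
  classical
  rw [expectedQueries, sum_listsOfLength_succ, expectedQueries, ← Finset.sum_add_distrib]
  refine Finset.sum_congr rfl fun h _ => ?_
  have key : ∀ z : 𝒳 × 𝒴, L.weight P (n + 1) (z :: h) * (queryCount x (z :: h) : ℝ) =
      L.weight P n h * ((L.query h z.1).toReal * (queryCount x h + if z.1 = x then 1 else 0) *
        (P.condLabel z.1 z.2).toReal) := fun z => by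
    rw [weight_succ_cons, queryCount]
    push_cast
    split_ifs <;> ring
  simp only [key]
  rw [← Finset.mul_sum, ← mul_add, Fintype.sum_prod_type]
  simp only [← Finset.mul_sum, PMF.sum_toReal_eq_one, mul_one, mul_add, Finset.sum_add_distrib,
    ← Finset.sum_mul, one_mul, mul_ite, mul_zero]
  simp

theorem sqrt_mul_le_add_div_two {a b : ℝ} (ha : 0 ≤ a) (hb : 0 ≤ b) : √(a * b) ≤ (a + b) / 2 := by
  rw [Real.sqrt_mul ha]
  nlinarith [sq_nonneg (√a - √b), Real.sq_sqrt ha, Real.sq_sqrt hb]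

/-- If two instances differ only at `x₀`, the loss of affinity is controlled by the expected number
of queries of `x₀`. -/
theorem one_sub_affinity_le (L : ActiveLearner 𝒳 𝒴) (P Q : RegressionInstance 𝒳 𝒴) (x₀ : 𝒳)
    (h : ∀ x, x ≠ x₀ → P.labelAffinity Q x = 1) (h₀ : P.labelAffinity Q x₀ ≤ 1) (n : ℕ) :
    1 - L.affinity P Q n ≤ (1 - P.labelAffinity Q x₀) *
      ((L.expectedQueries P n x₀ + L.expectedQueries Q n x₀) / 2) := by
  classical
  induction n with
  | zero => simp [affinity_zero, expectedQueries, listsOfLength, queryCount]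
  | succ n ih =>
    set b := P.labelAffinity Q x₀
    -- Only a query of `x₀` loses affinity, and it loses the fraction `1 - b`.
    have step : ∀ t, ∑ x, (L.query t x).toReal * P.labelAffinity Q x =
        1 - (1 - b) * (L.query t x₀).toReal := fun t => by
      have : ∀ x, (L.query t x).toReal * P.labelAffinity Q x =
          (L.query t x).toReal - if x = x₀ then (1 - b) * (L.query t x₀).toReal else 0 := by
        intro x
        split_ifs with hx
        · subst hx; ring
        · rw [h x hx]; ring
      simp only [this, Finset.sum_sub_distrib, PMF.sum_toReal_eq_one]
      rw [Finset.sum_ite_eq', if_pos (Finset.mem_univ _)]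
    -- AM-GM replaces the geometric mean of the two transcript weights by their average, which
    -- produces the expected query counts under both instances.
    have h2 : ∑ t ∈ listsOfLength (𝒳 × 𝒴) n,
        √(L.weight P n t * L.weight Q n t) * (L.query t x₀).toReal ≤
        (∑ t ∈ listsOfLength (𝒳 × 𝒴) n, L.weight P n t * (L.query t x₀).toReal +
          ∑ t ∈ listsOfLength (𝒳 × 𝒴) n, L.weight Q n t * (L.query t x₀).toReal) / 2 := by
      rw [← Finset.sum_add_distrib, Finset.sum_div]
      refine Finset.sum_le_sum fun t _ => ?_
      have := mul_le_mul_of_nonneg_right (sqrt_mul_le_add_div_two (L.weight_nonneg P n t)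
        (L.weight_nonneg Q n t)) (ENNReal.toReal_nonneg (a := L.query t x₀))
      linarith
    have h3 : L.affinity P Q (n + 1) = L.affinity P Q n - (1 - b) *
        ∑ t ∈ listsOfLength (𝒳 × 𝒴) n,
          √(L.weight P n t * L.weight Q n t) * (L.query t x₀).toReal := by
      rw [affinity_succ, affinity, Finset.mul_sum, ← Finset.sum_sub_distrib]
      refine Finset.sum_congr rfl fun t _ => ?_
      rw [step]
      ring
    rw [h3, expectedQueries_succ, expectedQueries_succ]
    have := mul_le_mul_of_nonneg_left h2 (sub_nonneg.2 h₀)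
    linarith

/-- If the likelihood ratio of `Q` to `P` is at least `r ^ 2` at `x₀` and at least one elsewhere, the
affinity is at least `r` to the expected number of queries of `x₀` under `P`. -/
theorem rpow_expectedQueries_le_affinity (L : ActiveLearner 𝒳 𝒴) (P Q : RegressionInstance 𝒳 𝒴)
    (x₀ : 𝒳) {r : ℝ} (hr : 0 < r)
    (h : ∀ x, x ≠ x₀ → ∀ y, P.condLabel x y ≤ Q.condLabel x y)
    (h₀ : ∀ y, r ^ 2 * (P.condLabel x₀ y).toReal ≤ (Q.condLabel x₀ y).toReal) (n : ℕ) :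
    r ^ L.expectedQueries P n x₀ ≤ L.affinity P Q n := by
  classical
  -- The likelihood ratio of a whole transcript loses at most a factor `r ^ 2` per query of `x₀`,
  -- since the query probabilities cancel.
  have key : ∀ n t, (r ^ queryCount x₀ t) ^ 2 * L.weight P n t ≤ L.weight Q n t := by
    intro n
    induction n with
    | zero =>
      intro t
      by_cases ht : t = []
      · subst ht; simp [queryCount, weight_zero_nil]
      · simp [weight, transcript, ht]
    | succ n ih =>
      rintro (_ | ⟨z, t⟩)
      · have hz : ([] : List (𝒳 × 𝒴)) ∉ listsOfLength (𝒳 × 𝒴) (n + 1) := fun hh => by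
          simpa using length_of_mem_listsOfLength hh
        simp [weight, transcript_eq_zero _ _ _ _ hz]
      · have hc : (r ^ (if z.1 = x₀ then 1 else 0)) ^ 2 * (P.condLabel z.1 z.2).toReal ≤
            (Q.condLabel z.1 z.2).toReal := by
          split_ifs with hx
          · rw [hx, pow_one]; exact h₀ _
          · simpa using ENNReal.toReal_mono (PMF.apply_ne_top _ _) (h _ hx z.2)
        rw [weight_succ_cons, weight_succ_cons, queryCount, pow_add]
        calc _ = ((r ^ queryCount x₀ t) ^ 2 * L.weight P n t) * ((L.query t z.1).toReal *
              ((r ^ (if z.1 = x₀ then 1 else 0)) ^ 2 * (P.condLabel z.1 z.2).toReal)) := by ring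
          _ ≤ _ := by
            gcongr
            · exact L.weight_nonneg Q n t
            · exact ih t
  set m := L.expectedQueries P n x₀
  -- Jensen's inequality for `k ↦ r ^ k`, in the form of its tangent line at the mean `m`; the
  -- linear term vanishes on averaging.
  have tangent : ∀ k : ℕ, r ^ m * (1 + (k - m) * Real.log r) ≤ r ^ k := fun k => by
    have : r ^ k = r ^ m * Real.exp ((k - m) * Real.log r) := by
      rw [← Real.rpow_natCast, Real.rpow_def_of_pos hr, Real.rpow_def_of_pos hr, ← Real.exp_add]
      congr 1; ring
    rw [this]
    gcongr
    linarith [Real.add_one_le_exp ((k - m) * Real.log r)]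
  calc r ^ m = ∑ t ∈ listsOfLength (𝒳 × 𝒴) n,
        L.weight P n t * (r ^ m * (1 + (queryCount x₀ t - m) * Real.log r)) := by
        have : ∀ t, L.weight P n t * (r ^ m * (1 + (queryCount x₀ t - m) * Real.log r)) =
            (r ^ m * (1 - m * Real.log r)) * L.weight P n t +
              (r ^ m * Real.log r) * (L.weight P n t * queryCount x₀ t) := fun t => by ring
        simp only [this, Finset.sum_add_distrib, ← Finset.mul_sum, sum_weight_eq_one]
        rw [show ∑ t ∈ listsOfLength (𝒳 × 𝒴) n, L.weight P n t * queryCount x₀ t = m from rfl]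
        ring
    _ ≤ L.affinity P Q n := by
        refine Finset.sum_le_sum fun t _ => ?_
        refine (mul_le_mul_of_nonneg_left (tangent _) (L.weight_nonneg P n t)).trans ?_
        refine Real.le_sqrt_of_sq_le ?_
        calc _ = L.weight P n t * ((r ^ queryCount x₀ t) ^ 2 * L.weight P n t) := by ring
          _ ≤ _ := mul_le_mul_of_nonneg_left (key n t) (L.weight_nonneg P n t)

/-- Two instances cannot be told apart with error probabilities below a quarter of the squared
affinity. -/
theorem affinity_le_sqrt_add_sqrt (L : ActiveLearner 𝒳 𝒴) (P Q : RegressionInstance 𝒳 𝒴) (n : ℕ)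
    {A : Set (Fin d → ℝ)} (hA : MeasurableSet A) :
    L.affinity P Q n ≤ √((L.outputLaw P n).real A) + √((L.outputLaw Q n).real Aᶜ) := by
  have cs : ∀ (P Q : RegressionInstance 𝒳 𝒴) (A : Set (Fin d → ℝ)), MeasurableSet A →
      ∑ h ∈ listsOfLength (𝒳 × 𝒴) n, √(L.weight P n h * L.weight Q n h) *
        (L.output h : Measure (Fin d → ℝ)).real A ≤ √((L.outputLaw P n).real A) := by
    intro P Q A hA
    have := Real.sum_sqrt_mul_sqrt_le (listsOfLength (𝒳 × 𝒴) n)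
      (f := fun h => L.weight P n h * (L.output h : Measure (Fin d → ℝ)).real A)
      (g := fun h => L.weight Q n h * (L.output h : Measure (Fin d → ℝ)).real A)
      (fun h => mul_nonneg (weight_nonneg ..) measureReal_nonneg)
      (fun h => mul_nonneg (weight_nonneg ..) measureReal_nonneg)
    rw [← outputLaw_real_apply _ _ _ hA, ← outputLaw_real_apply _ _ _ hA] at this
    calc _ = _ := Finset.sum_congr rfl fun h _ => ?_
      _ ≤ _ := this
      -- After Cauchy–Schwarz, the factor for the other instance is discarded, being at most one.
      _ ≤ √((L.outputLaw P n).real A) * 1 := by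
        gcongr
        exact Real.sqrt_le_one.2 measureReal_le_one
      _ = _ := mul_one _
    have hg := measureReal_nonneg (μ := (L.output h : Measure (Fin d → ℝ))) (s := A)
    rw [Real.sqrt_mul (weight_nonneg ..), Real.sqrt_mul (weight_nonneg ..),
      Real.sqrt_mul (weight_nonneg ..)]
    linear_combination (-√(L.weight P n h) * √(L.weight Q n h)) * Real.mul_self_sqrt hg
  refine le_trans (le_of_eq ?_) (add_le_add (cs P Q A hA) (cs Q P Aᶜ hA.compl))
  rw [affinity, ← Finset.sum_add_distrib]
  refine Finset.sum_congr rfl fun h _ => ?_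
  rw [mul_comm (L.weight Q n h), ← mul_add, measureReal_add_measureReal_compl hA, probReal_univ,
    mul_one]

/-- The total error of a test is at least the sum of the pointwise minima of the two weights, and
`min p q ≥ 4 * √(p * q) - 25 / 16 * (p + q)`. A bound linear in the affinity can be averaged over
many pairs of instances. At affinity one it gives `7 / 8`, which leaves room above the total error
`3 / 4` needed in the Assouad argument. -/
theorem four_mul_affinity_le (L : ActiveLearner 𝒳 𝒴) (P Q : RegressionInstance 𝒳 𝒴) (n : ℕ)
    {A : Set (Fin d → ℝ)} (hA : MeasurableSet A) :
    4 * L.affinity P Q n - 25 / 8 ≤ (L.outputLaw P n).real A + (L.outputLaw Q n).real Aᶜ := by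
  have h1 : (25 / 8 : ℝ) = ∑ h ∈ listsOfLength (𝒳 × 𝒴) n,
      25 / 16 * (L.weight P n h + L.weight Q n h) := by
    rw [← Finset.mul_sum, Finset.sum_add_distrib, sum_weight_eq_one, sum_weight_eq_one]
    norm_num
  rw [outputLaw_real_apply _ _ _ hA, outputLaw_real_apply _ _ _ hA.compl, affinity,
    Finset.mul_sum, h1, ← Finset.sum_sub_distrib, ← Finset.sum_add_distrib]
  refine Finset.sum_le_sum fun h _ => ?_
  rw [probReal_compl_eq_one_sub hA]
  have hg0 := measureReal_nonneg (μ := (L.output h : Measure (Fin d → ℝ))) (s := A)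
  have hg1 := measureReal_le_one (μ := (L.output h : Measure (Fin d → ℝ))) (s := A)
  have hp := L.weight_nonneg P n h
  have hq := L.weight_nonneg Q n h
  generalize (L.output h : Measure (Fin d → ℝ)).real A = g at *
  rw [Real.sqrt_mul hp]
  have ep := Real.sq_sqrt hp
  have eq := Real.sq_sqrt hq
  generalize √(L.weight P n h) = a at *
  generalize √(L.weight Q n h) = b at *
  rw [← ep, ← eq]
  -- The form `41 / 16 * a ^ 2 - 4 * a * b + 25 / 16 * b ^ 2` is positive definite, narrowly: `4 *
  -- 41 * 25 / 256 > 16`.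
  have ha : 0 ≤ a ^ 2 - 4 * (a * b) + 25 / 16 * (a ^ 2 + b ^ 2) := by
    nlinarith [sq_nonneg b, sq_nonneg (a - 32 / 41 * b)]
  have hb : 0 ≤ b ^ 2 - 4 * (a * b) + 25 / 16 * (a ^ 2 + b ^ 2) := by
    nlinarith [sq_nonneg a, sq_nonneg (b - 32 / 41 * a)]
  nlinarith [mul_nonneg hg0 ha, mul_nonneg (sub_nonneg.2 hg1) hb]

end ActiveLearner

/-! ### Instances with prescribed label laws -/

namespace RegressionInstance

section OfLabelLaw

variable {d : ℕ} {𝒳 : Finset (Fin d → ℝ)} {𝒴 : Finset ℝ}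

theorem map_fst_bind_map_mk (q : PMF 𝒳) (κ : 𝒳 → PMF 𝒴) :
    (q.bind fun x => (κ x).map (Prod.mk x)).map Prod.fst = q := by
  simp only [PMF.map_bind, PMF.map_comp]
  calc _ = q.bind PMF.pure := by
        congr 1
        funext x
        exact PMF.map_const _ _
    _ = q := PMF.bind_pure _

/-- The instance with a given law of the inputs and given conditional laws of the labels. -/
def ofLabelLaw (q : PMF 𝒳) (hq : ∀ x, q x ≠ 0) (κ : 𝒳 → PMF 𝒴) : RegressionInstance 𝒳 𝒴 where
  joint := q.bind fun x => (κ x).map (Prod.mk x)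
  marginal_ne_zero x := by rw [map_fst_bind_map_mk]; exact hq x

variable (q : PMF 𝒳) (hq : ∀ x, q x ≠ 0) (κ : 𝒳 → PMF 𝒴)

theorem marginal_ofLabelLaw : (ofLabelLaw q hq κ).marginal = q :=
  map_fst_bind_map_mk q κ

theorem joint_ofLabelLaw (x : 𝒳) (y : 𝒴) : (ofLabelLaw q hq κ).joint (x, y) = q x * κ x y := by
  rw [ofLabelLaw, PMF.bind_apply, tsum_eq_single x]
  · rw [PMF.map_apply, tsum_eq_single y]
    · simp
    · intro y' hy
      rw [if_neg]
      simpa using hy.symm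
  · intro x' hx
    rw [PMF.map_apply, ENNReal.tsum_eq_zero.2, mul_zero]
    intro y'
    rw [if_neg]
    simp [hx.symm]

theorem condLabel_ofLabelLaw (x : 𝒳) : (ofLabelLaw q hq κ).condLabel x = κ x := by
  classical
  ext y
  have total : ∑' z, Set.indicator {z : 𝒳 × 𝒴 | z.1 = x} (ofLabelLaw q hq κ).joint z = q x := by
    rw [ENNReal.tsum_prod', tsum_eq_single x]
    · have : ∀ b, Set.indicator {z : 𝒳 × 𝒴 | z.1 = x} (ofLabelLaw q hq κ).joint (x, b) =
          q x * κ x b := fun b => by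
        rw [Set.indicator_of_mem (by simp), joint_ofLabelLaw]
      simp only [this]
      rw [ENNReal.tsum_mul_left, PMF.tsum_coe, mul_one]
    · intro a ha
      rw [ENNReal.tsum_eq_zero]
      intro b
      exact Set.indicator_of_notMem (by simpa using ha) _
  rw [condLabel, PMF.map_apply, tsum_eq_single (x, y)]
  · rw [if_pos rfl, PMF.filter_apply, total, Set.indicator_of_mem (by simp), joint_ofLabelLaw,
      mul_comm (q x), mul_assoc, ENNReal.mul_inv_cancel (hq x) (PMF.apply_ne_top _ _), mul_one]
  · rintro ⟨a, b⟩ hab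
    split_ifs with hb
    · rw [PMF.filter_apply, Set.indicator_of_notMem, zero_mul]
      rintro ha
      exact hab (Prod.ext ha hb.symm)
    · rfl

end OfLabelLaw

theorem loss_nonneg {d : ℕ} {𝒳 : Finset (Fin d → ℝ)} {𝒴 : Finset ℝ} (P : RegressionInstance 𝒳 𝒴)
    (β : Fin d → ℝ) : 0 ≤ P.loss β :=
  Finset.sum_nonneg fun _ _ => mul_nonneg ENNReal.toReal_nonneg (abs_nonneg _)

theorem measurableSet_approxMinimizers {d : ℕ} {𝒳 : Finset (Fin d → ℝ)} {𝒴 : Finset ℝ}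
    (P : RegressionInstance 𝒳 𝒴) (ε : ℝ) : MeasurableSet (P.approxMinimizers ε) := by
  have : Continuous P.loss := by
    unfold loss dotProduct
    fun_prop
  exact (isClosed_le this continuous_const).measurableSet

end RegressionInstance

/-! ### Coins on the standard basis -/

/-- The two labels. -/
def zeroOne : Finset ℝ := {0, 1}

theorem card_zeroOne : zeroOne.card = 2 := by
  simp [zeroOne]

theorem zero_mem_zeroOne : (0 : ℝ) ∈ zeroOne :=
  Finset.mem_insert_self _ _

theorem one_mem_zeroOne : (1 : ℝ) ∈ zeroOne :=
  Finset.mem_insert_of_mem (Finset.mem_singleton_self _)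

theorem sum_zeroOne {M : Type*} [AddCommMonoid M] (f : zeroOne → M) :
    ∑ y, f y = f ⟨0, zero_mem_zeroOne⟩ + f ⟨1, one_mem_zeroOne⟩ := by
  classical
  have : (Finset.univ : Finset zeroOne) = {⟨0, zero_mem_zeroOne⟩, ⟨1, one_mem_zeroOne⟩} := by
    ext ⟨y, hy⟩
    have h : y = 0 ∨ y = 1 := by simpa [zeroOne] using hy
    simpa only [Finset.mem_univ, Finset.mem_insert, Finset.mem_singleton, Subtype.mk.injEq,
      true_iff] using h
  rw [this, Finset.sum_pair fun h => zero_ne_one (Subtype.mk.inj h)]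

/-- The law of a label that is `1` with probability `p` and `0` otherwise. -/
def coin (p : unitInterval) : PMF zeroOne :=
  PMF.ofFintype (fun y => open Classical in
    if (y : ℝ) = 1 then ENNReal.ofReal p else ENNReal.ofReal (1 - p)) (by
      rw [sum_zeroOne]
      simp only [zero_ne_one, if_false, if_true]
      rw [← ENNReal.ofReal_add (sub_nonneg.2 p.2.2) p.2.1]
      simp)

theorem coin_zero (p : unitInterval) (h : (0 : ℝ) ∈ zeroOne) :
    (coin p ⟨0, h⟩).toReal = 1 - p := by
  simp [coin, p.2.2]

theorem coin_one (p : unitInterval) (h : (1 : ℝ) ∈ zeroOne) : (coin p ⟨1, h⟩).toReal = p := by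
  simp [coin, p.2.1]

/-- The standard basis vectors. -/
def standardBasis (d : ℕ) : Finset (Fin d → ℝ) :=
  open Classical in Finset.univ.image fun i => Pi.single i 1

/-- The standard basis vectors, indexed by the coordinates. -/
def standardBasisEquiv (d : ℕ) : Fin d ≃ standardBasis d :=
  Equiv.ofBijective (fun i => ⟨Pi.single i 1, by simp [standardBasis]⟩)
    ⟨fun i j h => by
      by_contra hij
      simpa [hij] using congrFun (Subtype.ext_iff.1 h) i,
    fun ⟨x, hx⟩ => by
      simp only [standardBasis, Finset.mem_image, Finset.mem_univ, true_and] at hx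
      obtain ⟨i, hi⟩ := hx
      exact ⟨i, Subtype.ext hi⟩⟩

theorem coe_standardBasisEquiv {d : ℕ} (i : Fin d) :
    (standardBasisEquiv d i : Fin d → ℝ) = Pi.single i 1 :=
  rfl

instance (d : ℕ) [NeZero d] : Nonempty (standardBasis d) := ⟨standardBasisEquiv d 0⟩

/-- The uniform law on the standard basis. -/
def uniformBasis (d : ℕ) [NeZero d] : PMF (standardBasis d) :=
  PMF.uniformOfFintype _

theorem uniformBasis_apply {d : ℕ} [NeZero d] (x : standardBasis d) :
    uniformBasis d x = (d : ENNReal)⁻¹ := by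
  rw [uniformBasis, PMF.uniformOfFintype_apply, ← Fintype.card_congr (standardBasisEquiv d),
    Fintype.card_fin]

theorem uniformBasis_ne_zero {d : ℕ} [NeZero d] (x : standardBasis d) : uniformBasis d x ≠ 0 := by
  simp [uniformBasis_apply]

/-- A uniform standard basis vector, labelled by an independent coin whose bias depends on the
vector. -/
def coinInstance {d : ℕ} [NeZero d] (p : Fin d → unitInterval) :
    RegressionInstance (standardBasis d) zeroOne :=
  RegressionInstance.ofLabelLaw (uniformBasis d) uniformBasis_ne_zero
    fun x => coin (p ((standardBasisEquiv d).symm x))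

/-! ### Coordinatewise loss and misclassification -/

/-- The estimates whose `i`-th coordinate is closer to `1` than to `0`. -/
def roundsUp {d : ℕ} (i : Fin d) : Set (Fin d → ℝ) := {β | 1 / 2 ≤ β i}

theorem measurableSet_roundsUp {d : ℕ} (i : Fin d) : MeasurableSet (roundsUp i) :=
  (isClosed_le continuous_const (continuous_apply i)).measurableSet

/-- The cost equals `1 / 2` at `b = 1 / 2` whatever `p` is, and for `p ≤ 1 / 2` it does not decrease
to the right of that point. -/
theorem half_le_of_half_le {p b : ℝ} (hp : p ≤ 1 / 2) (hb : 1 / 2 ≤ b) :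
    1 / 2 ≤ p * |b - 1| + (1 - p) * |b| := by
  rw [abs_of_nonneg (by linarith : 0 ≤ b)]
  rcases le_total b 1 with h | h
  · rw [abs_of_nonpos (by linarith)]
    nlinarith
  · rw [abs_of_nonneg (by linarith)]
    nlinarith

theorem half_le_of_lt_half {p b : ℝ} (hp : 1 / 2 ≤ p) (hb : b < 1 / 2) :
    1 / 2 ≤ p * |b - 1| + (1 - p) * |b| := by
  have h := half_le_of_half_le (p := 1 - p) (b := 1 - b) (by linarith) (by linarith)
  rw [abs_sub_comm b 1, ← abs_neg b]
  rw [show 1 - b - 1 = -b by ring] at h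
  linarith

theorem min_le_label_loss {p : ℝ} (h0 : 0 ≤ p) (h1 : p ≤ 1) (b : ℝ) :
    min p (1 - p) ≤ p * |b - 1| + (1 - p) * |b| := by
  have h : 1 ≤ |b - 1| + |b| := by
    have := abs_sub b (b - 1)
    rw [show b - (b - 1) = 1 by ring, abs_one] at this
    linarith
  have ha := mul_le_mul_of_nonneg_right (min_le_left p (1 - p)) (abs_nonneg (b - 1))
  have hb := mul_le_mul_of_nonneg_right (min_le_right p (1 - p)) (abs_nonneg b)
  have hm : 0 ≤ min p (1 - p) := le_min h0 (by linarith)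
  nlinarith

/-- The estimates that are on the wrong side of `1 / 2` at the `i`-th coordinate. -/
def misclassifies {d : ℕ} (p : Fin d → unitInterval) (i : Fin d) : Set (Fin d → ℝ) :=
  open Classical in if (p i : ℝ) ≤ 1 / 2 then roundsUp i else (roundsUp i)ᶜ

theorem measurableSet_misclassifies {d : ℕ} (p : Fin d → unitInterval) (i : Fin d) :
    MeasurableSet (misclassifies p i) := by
  unfold misclassifies
  split_ifs
  exacts [measurableSet_roundsUp i, (measurableSet_roundsUp i).compl]

section CoinInstance

variable {d : ℕ} [NeZero d] (p r : Fin d → unitInterval)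

theorem marginal_coinInstance : (coinInstance p).marginal = uniformBasis d :=
  RegressionInstance.marginal_ofLabelLaw ..

theorem condLabel_coinInstance (i : Fin d) :
    (coinInstance p).condLabel (standardBasisEquiv d i) = coin (p i) := by
  rw [coinInstance, RegressionInstance.condLabel_ofLabelLaw, Equiv.symm_apply_apply]

theorem labelAffinity_coinInstance (i : Fin d) :
    (coinInstance p).labelAffinity (coinInstance r) (standardBasisEquiv d i) =
      √((1 - p i) * (1 - r i)) + √(p i * r i) := by
  rw [RegressionInstance.labelAffinity, condLabel_coinInstance, condLabel_coinInstance,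
    sum_zeroOne, coin_zero, coin_zero, coin_one, coin_one]

theorem labelAffinity_coinInstance_eq_one {i : Fin d} (h : p i = r i) :
    (coinInstance p).labelAffinity (coinInstance r) (standardBasisEquiv d i) = 1 := by
  rw [labelAffinity_coinInstance, h, Real.sqrt_mul_self (sub_nonneg.2 (r i).2.2),
    Real.sqrt_mul_self (r i).2.1]
  ring

theorem loss_coinInstance (β : Fin d → ℝ) :
    (coinInstance p).loss β =
      (d : ℝ)⁻¹ * ∑ i, ((p i : ℝ) * |β i - 1| + (1 - p i) * |β i|) := by
  rw [RegressionInstance.loss, Fintype.sum_prod_type, ← (standardBasisEquiv d).sum_comp,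
    Finset.mul_sum]
  refine Finset.sum_congr rfl fun i _ => ?_
  simp only [coinInstance, RegressionInstance.joint_ofLabelLaw, Equiv.symm_apply_apply,
    ENNReal.toReal_mul, uniformBasis_apply]
  rw [sum_zeroOne, coin_zero, coin_one, coe_standardBasisEquiv, single_one_dotProduct]
  simp only [ENNReal.toReal_inv, ENNReal.toReal_natCast, sub_zero]
  ring

theorem iInf_loss_coinInstance_le :
    ⨅ β, (coinInstance p).loss β ≤ (d : ℝ)⁻¹ * ∑ i, min (p i : ℝ) (1 - p i) := by
  classical
  have hb : BddBelow (Set.range (coinInstance p).loss) :=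
    ⟨0, by rintro _ ⟨β, rfl⟩; exact (coinInstance p).loss_nonneg β⟩
  refine (ciInf_le hb fun i => if (p i : ℝ) ≤ 1 - p i then 0 else 1).trans_eq ?_
  rw [loss_coinInstance]
  congr 1
  refine Finset.sum_congr rfl fun i _ => ?_
  split_ifs with h
  · simp [min_eq_left h]
  · simp [min_eq_right (not_le.1 h).le]

/-- Every coordinate costs at least its minimum and a misclassified one at least `1 / 2`; the total
excess must fit in the budget `ε` times the optimum. The factor `1 / d` cancels. -/
theorem sum_misclassifies_le {ε : ℝ} (hε : 0 ≤ 1 + ε) {β : Fin d → ℝ}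
    (hβ : β ∈ (coinInstance p).approxMinimizers ε) :
    ∑ i, (misclassifies p i).indicator (fun _ => 1 / 2 - min (p i : ℝ) (1 - p i)) β ≤
      ε * ∑ i, min (p i : ℝ) (1 - p i) := by
  have hd : (0 : ℝ) < (d : ℝ)⁻¹ := inv_pos.2 (Nat.cast_pos.2 (NeZero.pos d))
  have h1 : (coinInstance p).loss β ≤ (1 + ε) * ⨅ β', (coinInstance p).loss β' := hβ
  have h2 := h1.trans (mul_le_mul_of_nonneg_left (iInf_loss_coinInstance_le p) hε)
  rw [loss_coinInstance, mul_left_comm, mul_le_mul_iff_right₀ hd] at h2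
  have h3 : ∑ i, ((misclassifies p i).indicator (fun _ => 1 / 2 - min (p i : ℝ) (1 - p i)) β +
      min (p i : ℝ) (1 - p i)) ≤ ∑ i, ((p i : ℝ) * |β i - 1| + (1 - p i) * |β i|) := by
    refine Finset.sum_le_sum fun i _ => ?_
    by_cases h : β ∈ misclassifies p i
    · rw [Set.indicator_of_mem h, sub_add_cancel]
      unfold misclassifies at h
      split_ifs at h with hp
      · exact half_le_of_half_le hp h
      · exact half_le_of_lt_half (not_le.1 hp).le (not_le.1 h)
    · rw [Set.indicator_of_notMem h, zero_add]
      exact min_le_label_loss (p i).2.1 (p i).2.2 _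
  rw [Finset.sum_add_distrib] at h3
  linarith

theorem not_mem_misclassifies {ε : ℝ} (hε : 0 ≤ 1 + ε) {β : Fin d → ℝ}
    (hβ : β ∈ (coinInstance p).approxMinimizers ε) (i : Fin d)
    (h : ε * ∑ i, min (p i : ℝ) (1 - p i) < 1 / 2 - min (p i : ℝ) (1 - p i)) :
    β ∉ misclassifies p i := by
  intro hi
  have h1 := sum_misclassifies_le p hε hβ
  have h2 := Finset.single_le_sum (s := Finset.univ)
    (f := fun i => (misclassifies p i).indicator (fun _ => 1 / 2 - min (p i : ℝ) (1 - p i)) β)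
    (fun j _ => Set.indicator_nonneg (fun _ _ => by
      rcases le_total (p j : ℝ) (1 / 2) with hj | hj
      · linarith [min_le_left (p j : ℝ) (1 - p j)]
      · linarith [min_le_right (p j : ℝ) (1 - p j)]) _) (Finset.mem_univ i)
  simp only [Set.indicator_of_mem hi] at h2
  linarith

end CoinInstance

/-! ### From solving to testing -/

namespace ActiveLearner

variable {d : ℕ} {𝒳 : Finset (Fin d → ℝ)} {𝒴 : Finset ℝ}

theorem Solves.real_compl_le {L : ActiveLearner 𝒳 𝒴} {P : RegressionInstance 𝒳 𝒴} {N : ℕ}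
    {ε δ : ℝ} (h : L.Solves P N ε δ) : (L.outputLaw P N).real (P.approxMinimizers ε)ᶜ ≤ δ := by
  have hm := P.measurableSet_approxMinimizers ε
  rw [Solves, ← outputLaw_apply _ _ _ hm, ENNReal.ofReal_le_iff_le_toReal (measure_ne_top _ _)] at h
  rw [probReal_compl_eq_one_sub hm, Measure.real]
  linarith

/-- Solving both instances would test between them, with both error probabilities at most `δ`. -/
theorem affinity_le_two_mul_sqrt {L : ActiveLearner 𝒳 𝒴} {P Q : RegressionInstance 𝒳 𝒴} {N : ℕ}
    {ε δ : ℝ} (hP : L.Solves P N ε δ) (hQ : L.Solves Q N ε δ) {A : Set (Fin d → ℝ)}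
    (hA : MeasurableSet A) (hPA : P.approxMinimizers ε ⊆ Aᶜ) (hQA : Q.approxMinimizers ε ⊆ A) :
    L.affinity P Q N ≤ 2 * √δ := by
  have h1 : √((L.outputLaw P N).real A) ≤ √δ := Real.sqrt_le_sqrt <|
    (measureReal_mono (Set.subset_compl_comm.1 hPA)).trans hP.real_compl_le
  have h2 : √((L.outputLaw Q N).real Aᶜ) ≤ √δ := Real.sqrt_le_sqrt <|
    (measureReal_mono (Set.compl_subset_compl.2 hQA)).trans hQ.real_compl_le
  linarith [L.affinity_le_sqrt_add_sqrt P Q N hA]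

end ActiveLearner

/-- This is `t ≤ √t` on `[0, 1]` at `t = 1 - 4 * γ ^ 2`; it bounds the affinity of the coins with
biases `1 / 2 ± γ`. -/
theorem half_sub_sq_le_sqrt {γ : ℝ} (h : γ ^ 2 ≤ 1 / 4) :
    (1 - 4 * γ ^ 2) / 2 ≤ √(1 / 4 - γ ^ 2) := by
  refine Real.le_sqrt_of_sq_le ?_
  nlinarith [mul_nonneg (sq_nonneg γ) (sub_nonneg.2 h)]

theorem log_le_of_le_two_mul_sqrt {δ a : ℝ} (hδ : 0 < δ) (ha : Real.exp (-a) ≤ 2 * √δ) :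
    Real.log (1 / (4 * δ)) ≤ 2 * a := by
  have h : Real.exp (-a) ^ 2 ≤ 4 * δ := by
    calc _ ≤ (2 * √δ) ^ 2 := by gcongr
      _ = 4 * δ := by rw [mul_pow, Real.sq_sqrt hδ.le]; norm_num
  rw [← Real.exp_nat_mul, ← Real.le_log_iff_exp_le (by positivity)] at h
  rw [one_div, Real.log_inv]
  push_cast at h
  linarith

/-! ### The hypercube of biased coins -/

section SignedCoins

variable {d : ℕ}

/-- The coins whose biases are `γ` away from `1 / 2` in the given directions. -/
def signedCoins {γ : ℝ} (hγ : γ ∈ Set.Icc (0 : ℝ) (1 / 2)) (s : Fin d → Bool) (i : Fin d) :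
    unitInterval :=
  if s i then ⟨1 / 2 + γ, by linarith [hγ.1], by linarith [hγ.2]⟩
  else ⟨1 / 2 - γ, by linarith [hγ.2], by linarith [hγ.1]⟩

/-- The sign vector with the `i`-th sign reversed. -/
def flipSign (i : Fin d) (s : Fin d → Bool) : Fin d → Bool := Function.update s i (!s i)

theorem flipSign_involutive (i : Fin d) : Function.Involutive (flipSign i) := fun s => by
  simp [flipSign]

theorem sum_flipSign (i : Fin d) (f : (Fin d → Bool) → ℝ) :
    ∑ s, f (flipSign i s) = ∑ s, f s :=
  Equiv.sum_comp (flipSign_involutive i).toPerm f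

variable {γ : ℝ} (hγ : γ ∈ Set.Icc (0 : ℝ) (1 / 2)) (s : Fin d → Bool)

theorem min_signedCoins (i : Fin d) :
    min (signedCoins hγ s i : ℝ) (1 - signedCoins hγ s i) = 1 / 2 - γ := by
  unfold signedCoins
  split_ifs
  · rw [min_eq_right (by simp only; linarith [hγ.1])]
    ring
  · rw [min_eq_left (by simp only; linarith [hγ.1])]

/-- Reversing the sign swaps the right and wrong sides, so the two errors are complementary. At `γ =
0` both coins would be fair and the two sets equal. -/
theorem misclassifies_flipSign (h : 0 < γ) (i : Fin d) :
    misclassifies (signedCoins hγ (flipSign i s)) i = (misclassifies (signedCoins hγ s) i)ᶜ := by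
  have h1 : ¬ (1 / 2 + γ ≤ 1 / 2) := by linarith
  have h2 : 1 / 2 - γ ≤ 1 / 2 := by linarith
  cases hs : s i <;> simp only [misclassifies, signedCoins, flipSign, Function.update_self, hs]
  · simp [h1, h2, -one_div, -sub_le_self_iff]
  · simp [h1, h2, -one_div, -sub_le_self_iff]

end SignedCoins

/-! ### The three lower bounds -/

section LowerBounds

variable {d : ℕ} [NeZero d]

/-- The instance in which the label is `1` with probability `p` at the `i`-th basis vector and
always `0` elsewhere. -/
def singleCoinInstance (i : Fin d) (p : unitInterval) :
    RegressionInstance (standardBasis d) zeroOne :=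
  coinInstance (Pi.single i p)

/-- The deterministic coordinates add nothing to the optimal loss, so the whole error budget is `ε`
times the cost of the single coin. -/
theorem not_mem_misclassifies_single (i : Fin d) (p : unitInterval) {ε : ℝ} (hε : 0 ≤ ε)
    (h : (1 + ε) * min (p : ℝ) (1 - p) < 1 / 2) {β : Fin d → ℝ}
    (hβ : β ∈ (singleCoinInstance i p).approxMinimizers ε) :
    β ∉ misclassifies (Pi.single i p) i := by
  refine not_mem_misclassifies _ (by linarith) hβ i ?_
  rw [Finset.sum_eq_single i]
  · rw [Pi.single_eq_same]
    linarith
  · intro j _ hj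
    simp [hj]
  · simp

theorem approxMinimizers_single_subset_compl (i : Fin d) (p : unitInterval) {ε : ℝ} (hε : 0 ≤ ε)
    (hp : (p : ℝ) ≤ 1 / 2) (h : (1 + ε) * p < 1 / 2) :
    (singleCoinInstance i p).approxMinimizers ε ⊆ (roundsUp i)ᶜ := by
  intro β hβ
  have := not_mem_misclassifies_single i p hε
    ((mul_le_mul_of_nonneg_left (min_le_left _ _) (by linarith)).trans_lt h) hβ
  rwa [misclassifies, Pi.single_eq_same, if_pos hp] at this

theorem approxMinimizers_single_subset (i : Fin d) (p : unitInterval) {ε : ℝ} (hε : 0 ≤ ε)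
    (hp : 1 / 2 < (p : ℝ)) (h : (1 + ε) * (1 - p) < 1 / 2) :
    (singleCoinInstance i p).approxMinimizers ε ⊆ roundsUp i := by
  intro β hβ
  have := not_mem_misclassifies_single i p hε
    ((mul_le_mul_of_nonneg_left (min_le_right _ _) (by linarith)).trans_lt h) hβ
  rwa [misclassifies, Pi.single_eq_same, if_neg (not_le.2 hp), Set.notMem_compl_iff] at this

variable {ε δ : ℝ} {N : ℕ} {L : ActiveLearner (standardBasis d) zeroOne}

theorem log_div_sq_le_of_solves (hε : 0 < ε) (hε' : ε < 1 / 10) (hδ : 0 < δ)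
    (hL : ∀ P : RegressionInstance (standardBasis d) zeroOne, P.marginal = uniformBasis d →
      L.Solves P N ε δ) :
    1 / ε ^ 2 * Real.log (1 / (4 * δ)) ≤ 16 * N := by
  -- Bias `ε` suffices, because `(1 + ε) * (1 / 2 - ε) < 1 / 2`.
  let p : unitInterval := ⟨1 / 2 - ε, by linarith, by linarith⟩
  let r : unitInterval := ⟨1 / 2 + ε, by linarith, by linarith⟩
  let i : Fin d := 0
  have hb : ∀ x, 1 - 4 * ε ^ 2 ≤
      (singleCoinInstance i p).labelAffinity (singleCoinInstance i r) x := by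
    intro x
    obtain ⟨j, rfl⟩ := (standardBasisEquiv d).surjective x
    by_cases hj : j = i
    · rw [hj, singleCoinInstance, singleCoinInstance, labelAffinity_coinInstance,
        Pi.single_eq_same, Pi.single_eq_same]
      have h1 := half_sub_sq_le_sqrt (γ := ε) (by nlinarith)
      rw [show (1 - (p : ℝ)) * (1 - r) = 1 / 4 - ε ^ 2 by simp only [p, r]; ring,
        show (p : ℝ) * r = 1 / 4 - ε ^ 2 by simp only [p, r]; ring]
      linarith
    · rw [singleCoinInstance, singleCoinInstance, labelAffinity_coinInstance_eq_one]
      · nlinarith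
      · rw [Pi.single_eq_of_ne hj, Pi.single_eq_of_ne hj]
  have h1 := L.pow_le_affinity _ _ (by nlinarith) hb N
  have h2 := ActiveLearner.affinity_le_two_mul_sqrt
    (hL (singleCoinInstance i p) (marginal_coinInstance _))
    (hL (singleCoinInstance i r) (marginal_coinInstance _)) (measurableSet_roundsUp i)
    (approxMinimizers_single_subset_compl i p hε.le (by simp only [p]; linarith)
      (by simp only [p]; nlinarith))
    (approxMinimizers_single_subset i r hε.le (by simp only [r]; linarith)
      (by simp only [r]; nlinarith))
  -- The inequality `exp (-2 * x) ≤ 1 - x` at `x = 4 * ε ^ 2`, valid since `x ≤ 1 / 2`.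
  have h3 : Real.exp (-(N * (8 * ε ^ 2))) ≤ (1 - 4 * ε ^ 2) ^ N := by
    rw [← mul_neg, Real.exp_nat_mul]
    gcongr
    have h4 := Real.one_sub_inv_le_log_of_pos (x := 1 - 4 * ε ^ 2) (by nlinarith)
    rw [← Real.le_log_iff_exp_le (by nlinarith)]
    refine le_trans ?_ h4
    have h5 : (1 - 4 * ε ^ 2)⁻¹ ≤ 1 + 8 * ε ^ 2 := by
      rw [inv_le_iff_one_le_mul₀ (by nlinarith)]
      have : 0 ≤ 1 / 8 - ε ^ 2 := by nlinarith
      nlinarith [mul_nonneg (sq_nonneg ε) this]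
    linarith
  have h6 := log_le_of_le_two_mul_sqrt hδ (h3.trans (h1.trans h2))
  rw [one_div, inv_mul_le_iff₀ (by positivity)]
  linarith

theorem mul_log_le_of_solves (hε : 0 < ε) (hε' : ε < 1 / 10) (hδ : 0 < δ)
    (hL : ∀ P : RegressionInstance (standardBasis d) zeroOne, P.marginal = uniformBasis d →
      L.Solves P N ε δ) :
    d * Real.log (1 / (4 * δ)) ≤ 2 * N := by
  have hd : (0 : ℝ) < d := Nat.cast_pos.2 (NeZero.pos d)
  let P₀ : RegressionInstance (standardBasis d) zeroOne := coinInstance 0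
  -- The expected query counts under the all-zero instance sum to `N`, so some coordinate gets at
  -- most the average.
  obtain ⟨i, hi⟩ : ∃ i, L.expectedQueries P₀ N (standardBasisEquiv d i) ≤ N / d := by
    by_contra! h
    have h1 := Finset.sum_lt_sum_of_nonempty Finset.univ_nonempty fun i _ => h i
    rw [(standardBasisEquiv d).sum_comp (fun x => L.expectedQueries P₀ N x),
      L.sum_expectedQueries, Finset.sum_const, Finset.card_univ, Fintype.card_fin, nsmul_eq_mul,
      mul_div_cancel₀ _ hd.ne'] at h1
    exact lt_irrefl _ h1
  -- With bias `3 / 4` the label `0` keeps probability `(1 / 2) ^ 2`, yet `(1 + ε) / 4 < 1 / 2`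
  -- forces rounding up at `i`.
  let r : unitInterval := ⟨3 / 4, by norm_num, by norm_num⟩
  have hP₀ : P₀ = singleCoinInstance i 0 := by rw [singleCoinInstance, Pi.single_zero]
  have h1 := L.rpow_expectedQueries_le_affinity P₀ (singleCoinInstance i r)
    (standardBasisEquiv d i) (r := 1 / 2) (by norm_num) (by
      intro x hx y
      obtain ⟨j, rfl⟩ := (standardBasisEquiv d).surjective x
      rw [condLabel_coinInstance, singleCoinInstance, condLabel_coinInstance,
        Pi.single_eq_of_ne (by rintro rfl; exact hx rfl), Pi.zero_apply]) (by
      rintro ⟨y, hy⟩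
      rw [condLabel_coinInstance, singleCoinInstance, condLabel_coinInstance, Pi.single_eq_same,
        Pi.zero_apply]
      have hy' : y = 0 ∨ y = 1 := by simpa [zeroOne] using hy
      rcases hy' with rfl | rfl
      · rw [coin_zero, coin_zero]
        norm_num [r]
      · rw [coin_one, coin_one]
        norm_num [r]) N
  have h2 := ActiveLearner.affinity_le_two_mul_sqrt
    (hL P₀ (marginal_coinInstance _))
    (hL (singleCoinInstance i r) (marginal_coinInstance _)) (measurableSet_roundsUp i)
    (hP₀ ▸ approxMinimizers_single_subset_compl i 0 hε.le (by norm_num) (by norm_num))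
    (approxMinimizers_single_subset i r hε.le (by norm_num [r]) (by simp only [r]; linarith))
  have h3 : Real.exp (-(N / d : ℝ)) ≤ (1 / 2 : ℝ) ^ L.expectedQueries P₀ N
      (standardBasisEquiv d i) := by
    refine le_trans ?_ (Real.rpow_le_rpow_of_exponent_ge (by norm_num) (by norm_num) hi)
    rw [Real.rpow_def_of_pos (by norm_num), one_div, Real.log_inv]
    gcongr
    have : (0 : ℝ) ≤ N / d := by positivity
    nlinarith [Real.log_two_lt_d9]
  have h6 := log_le_of_le_two_mul_sqrt hδ (h3.trans (h1.trans h2))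
  rw [← mul_div_assoc, le_div_iff₀ hd] at h6
  linarith

section SignedCoins

variable {γ : ℝ} (hγ : γ ∈ Set.Icc (0 : ℝ) (1 / 2)) (s : Fin d → Bool)

theorem one_sub_labelAffinity_flipSign_le (i : Fin d) :
    1 - (coinInstance (signedCoins hγ s)).labelAffinity
      (coinInstance (signedCoins hγ (flipSign i s))) (standardBasisEquiv d i) ≤ 4 * γ ^ 2 := by
  rw [labelAffinity_coinInstance]
  have h1 := half_sub_sq_le_sqrt (γ := γ) (by nlinarith [hγ.1, hγ.2])
  have h2 : (signedCoins hγ s i : ℝ) * signedCoins hγ (flipSign i s) i = 1 / 4 - γ ^ 2 := by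
    cases hs : s i <;> simp [signedCoins, flipSign, hs] <;> ring
  have h3 : (1 - signedCoins hγ s i : ℝ) * (1 - signedCoins hγ (flipSign i s) i) =
      1 / 4 - γ ^ 2 := by
    cases hs : s i <;> simp [signedCoins, flipSign, hs] <;> ring
  rw [h2, h3]
  linarith

theorem affinity_flipSign_ge (L : ActiveLearner (standardBasis d) zeroOne) (N : ℕ) (i : Fin d) :
    1 - 4 * γ ^ 2 *
      ((L.expectedQueries (coinInstance (signedCoins hγ s)) N (standardBasisEquiv d i) +
        L.expectedQueries (coinInstance (signedCoins hγ (flipSign i s))) N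
          (standardBasisEquiv d i)) / 2) ≤
    L.affinity (coinInstance (signedCoins hγ s))
      (coinInstance (signedCoins hγ (flipSign i s))) N := by
  have h := L.one_sub_affinity_le (coinInstance (signedCoins hγ s))
    (coinInstance (signedCoins hγ (flipSign i s))) (standardBasisEquiv d i) (by
      intro x hx
      obtain ⟨j, rfl⟩ := (standardBasisEquiv d).surjective x
      refine labelAffinity_coinInstance_eq_one _ _ ?_
      rw [signedCoins, signedCoins, flipSign,
        Function.update_of_ne (by rintro rfl; exact hx rfl)]) (by
      refine (Finset.sum_le_sum fun y _ => ActiveLearner.sqrt_mul_le_add_div_two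
        ENNReal.toReal_nonneg ENNReal.toReal_nonneg).trans_eq ?_
      rw [← Finset.sum_div, Finset.sum_add_distrib, PMF.sum_toReal_eq_one, PMF.sum_toReal_eq_one]
      norm_num) N
  have hE : ∀ P : RegressionInstance (standardBasis d) zeroOne,
      0 ≤ L.expectedQueries P N (standardBasisEquiv d i) := fun P =>
    Finset.sum_nonneg fun _ _ => mul_nonneg (L.weight_nonneg ..) (Nat.cast_nonneg _)
  have := mul_le_mul_of_nonneg_right (one_sub_labelAffinity_flipSign_le hγ s i)
    (div_nonneg (add_nonneg (hE (coinInstance (signedCoins hγ s)))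
      (hE (coinInstance (signedCoins hγ (flipSign i s))))) zero_le_two)
  linarith

/-- On success at most `d / 8` coordinates are misclassified; failure has probability below `1 / 4`
and costs at most `d` more. Hence `1 / 8 + 1 / 4 = 3 / 8`. -/
theorem sum_real_misclassifies_le (hε : 0 < ε) (hεγ : γ = 4 * ε) (hδ' : δ < 1 / 4)
    (hL : L.Solves (coinInstance (signedCoins hγ s)) N ε δ) :
    ∑ i, (L.outputLaw (coinInstance (signedCoins hγ s)) N).real
      (misclassifies (signedCoins hγ s) i) ≤ 3 / 8 * d := by
  set P := coinInstance (signedCoins hγ s)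
  set ν := L.outputLaw P N
  have hm := fun i => measurableSet_misclassifies (signedCoins hγ s) i
  have hG := (P.measurableSet_approxMinimizers ε).compl
  have pointwise : ∀ β, ∑ i,
      (misclassifies (signedCoins hγ s) i).indicator (1 : (Fin d → ℝ) → ℝ) β ≤
      d / 8 + d * (P.approxMinimizers ε)ᶜ.indicator (1 : (Fin d → ℝ) → ℝ) β := by
    intro β
    by_cases hβ : β ∈ P.approxMinimizers ε
    · have h := sum_misclassifies_le _ (by linarith) hβ
      simp only [min_signedCoins, Finset.sum_const, Finset.card_univ, Fintype.card_fin,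
        nsmul_eq_mul] at h
      have h1 : ∀ i, (misclassifies (signedCoins hγ s) i).indicator
          (fun _ => 1 / 2 - (1 / 2 - γ)) β =
          γ * (misclassifies (signedCoins hγ s) i).indicator (1 : (Fin d → ℝ) → ℝ) β := fun i => by
        by_cases hi : β ∈ misclassifies (signedCoins hγ s) i <;> simp [hi]
      simp only [h1, ← Finset.mul_sum] at h
      rw [Set.indicator_of_notMem (by simpa using hβ), mul_zero, add_zero]
      -- Each misclassification has excess `γ = 4 * ε`, against a budget of `ε * d * (1 / 2 - γ) ≤ γ
      -- * d / 8`.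
      refine le_of_mul_le_mul_left (h.trans ?_) (by linarith : 0 < γ)
      have : 0 ≤ ε * d * γ := by have := hγ.1; positivity
      rw [hεγ] at this ⊢
      linarith
    · rw [Set.indicator_of_mem (by simpa using hβ)]
      have h : ∑ i, (misclassifies (signedCoins hγ s) i).indicator (1 : (Fin d → ℝ) → ℝ) β ≤
          ∑ i : Fin d, 1 := Finset.sum_le_sum fun i _ => Set.indicator_le_self' (by simp) β
      simp only [Finset.sum_const, Finset.card_univ, Fintype.card_fin, nsmul_eq_mul,
        mul_one] at h
      simp only [Pi.one_apply, mul_one]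
      have : (0 : ℝ) ≤ d / 8 := by positivity
      linarith
  have int : ∀ {S : Set (Fin d → ℝ)}, MeasurableSet S →
      Integrable (S.indicator (1 : (Fin d → ℝ) → ℝ)) ν :=
    fun hS => (integrable_const (1 : ℝ)).indicator hS
  have h := integral_mono (μ := ν) (integrable_finsetSum _ fun i _ => int (hm i))
    ((integrable_const _).add ((int hG).const_mul (d : ℝ))) pointwise
  rw [integral_finsetSum _ fun i _ => int (hm i)] at h
  simp only [Pi.add_apply] at h
  rw [integral_add (integrable_const _) ((int hG).const_mul _), integral_const_mul,
    integral_indicator_one hG] at h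
  simp only [integral_indicator_one (hm _), integral_const, probReal_univ, one_smul] at h
  have h2 := mul_le_mul_of_nonneg_left (hL.real_compl_le.trans hδ'.le) (Nat.cast_nonneg (α := ℝ) d)
  linarith

end SignedCoins

/-- Assouad's argument: neighbouring sign vectors are hard to tell apart unless the flipped
coordinate is queried often, yet the query counts sum to only `N`. Averaging over all signs compares
the forced errors with the allowed `3 / 8 * d`. -/
theorem div_sq_le_of_solves (hε : 0 < ε) (hε' : ε < 1 / 10) (hδ' : δ < 1 / 4)
    (hL : ∀ P : RegressionInstance (standardBasis d) zeroOne, P.marginal = uniformBasis d →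
      L.Solves P N ε δ) :
    d / ε ^ 2 ≤ 2048 * N := by
  have hγ : 4 * ε ∈ Set.Icc (0 : ℝ) (1 / 2) := ⟨by linarith, by linarith⟩
  let P (s : Fin d → Bool) := coinInstance (signedCoins hγ s)
  let E (s : Fin d → Bool) (i : Fin d) := L.expectedQueries (P s) N (standardBasisEquiv d i)
  let W (s : Fin d → Bool) (i : Fin d) :=
    (L.outputLaw (P s) N).real (misclassifies (signedCoins hγ s) i)
  have hE : ∀ s, ∑ i, E s i = N := fun s => by
    rw [← L.sum_expectedQueries (P s) N, ← (standardBasisEquiv d).sum_comp]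
  have hW : ∀ s, ∑ i, W s i ≤ 3 / 8 * d := fun s =>
    sum_real_misclassifies_le hγ s hε rfl hδ' (hL (P s) (marginal_coinInstance _))
  -- Here `7 / 8 = 4 - 25 / 8`, and the coefficient is `4 * (4 * γ ^ 2) / 2` with `γ = 4 * ε`.
  have pair : ∀ i s, 7 / 8 - 8 * (4 * ε) ^ 2 * (E s i + E (flipSign i s) i) ≤
      W s i + W (flipSign i s) i := fun i s => by
    have h1 := L.four_mul_affinity_le (P s) (P (flipSign i s)) N
      (measurableSet_misclassifies (signedCoins hγ s) i)
    rw [← misclassifies_flipSign hγ s (by linarith) i] at h1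
    have h2 := affinity_flipSign_ge hγ s L N i
    linarith
  -- Flipping a sign permutes the sign vectors, so each pair is counted twice and the bound is
  -- halved.
  have coord : ∀ i, ∑ s, (7 / 16 - 8 * (4 * ε) ^ 2 * E s i) ≤ ∑ s, W s i := fun i => by
    have h := Finset.sum_le_sum fun s (_ : s ∈ Finset.univ) => pair i s
    simp only [Finset.sum_sub_distrib, Finset.sum_add_distrib, ← Finset.mul_sum,
      sum_flipSign i (fun s => E s i), sum_flipSign i (fun s => W s i), Finset.sum_const,
      nsmul_eq_mul] at h ⊢
    linarith
  have h := Finset.sum_le_sum fun i (_ : i ∈ Finset.univ) => coord i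
  rw [Finset.sum_comm, Finset.sum_comm (f := fun i s => W s i)] at h
  have h' := h.trans (Finset.sum_le_sum fun s _ => hW s)
  simp only [Finset.sum_sub_distrib, ← Finset.mul_sum, hE, Finset.sum_const, nsmul_eq_mul,
    Finset.card_univ, Fintype.card_fin] at h'
  have hc : (0 : ℝ) < (Fintype.card (Fin d → Bool) : ℝ) := Nat.cast_pos.2 Fintype.card_pos
  -- The gap `7 / 16 - 3 / 8 = 1 / 16` against `128 * ε ^ 2 * N` gives the constant `2048`.
  have h3 : d * (7 / 16) - 8 * (4 * ε) ^ 2 * N ≤ 3 / 8 * (d : ℝ) :=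
    le_of_mul_le_mul_left (by linarith) hc
  rw [div_le_iff₀ (by positivity)]
  linarith

end LowerBounds

end

/-! ### Combining the bounds -/

theorem theorem4 :
    ∃ c : ℝ, 0 < c ∧
      ∀ (d : ℕ) (ε δ : ℝ), 2 ≤ d → 0 < ε → ε < 1 / 10 → 0 < δ → δ < 1 / 4 →
        ∃ (𝒳 : Finset (Fin d → ℝ)) (𝒴 : Finset ℝ) (q : PMF 𝒳),
          𝒴.card = 2 ∧ (∀ x, q x ≠ 0) ∧
          ∀ (N : ℕ) (L : ActiveLearner 𝒳 𝒴),
            (∀ P : RegressionInstance 𝒳 𝒴, P.marginal = q → L.Solves P N ε δ) →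
              c * (d / ε ^ 2 + 1 / ε ^ 2 * Real.log (1 / δ) + d * Real.log (1 / δ)) ≤ N := by
  -- The two cases below need `2048 + 32 + 4` and `2048 * (1 + 3 / 2 + 1) = 7168` respectively;
  -- `8192` covers both.
  refine ⟨1 / 8192, by norm_num, fun d ε δ hd hε hε' hδ hδ' => ?_⟩
  have : NeZero d := ⟨by omega⟩
  refine ⟨standardBasis d, zeroOne, uniformBasis d, card_zeroOne, uniformBasis_ne_zero,
    fun N L hL => ?_⟩
  have h1 := div_sq_le_of_solves hε hε' hδ' hL
  have h2 := log_div_sq_le_of_solves hε hε' hδ hL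
  have h3 := mul_log_le_of_solves hε hε' hδ hL
  have hd' : (2 : ℝ) ≤ d := by exact_mod_cast hd
  -- The bounds involve `log (1 / (4 * δ))`, which degenerates as `δ` approaches `1 / 4`. For `δ ≤ 1
  -- / 16` it is at least half of `log (1 / δ)`; otherwise `log (1 / δ) ≤ 3`, and the logarithmic
  -- terms are absorbed by `d / ε ^ 2`.
  rcases le_total δ (1 / 16) with h | h
  · have hl : Real.log (1 / δ) ≤ 2 * Real.log (1 / (4 * δ)) := by
      rw [← Real.log_rpow (by positivity)]
      refine Real.log_le_log (by positivity) ?_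
      rw [Real.rpow_ofNat, div_pow, div_le_div_iff₀ hδ (by positivity)]
      nlinarith
    have h4 := mul_le_mul_of_nonneg_left hl (by positivity : 0 ≤ 1 / ε ^ 2)
    have h5 := mul_le_mul_of_nonneg_left hl (by positivity : (0 : ℝ) ≤ d)
    have : (0 : ℝ) ≤ N := by positivity
    linarith
  · have hl : Real.log (1 / δ) ≤ 3 := by
      calc _ ≤ Real.log (2 ^ 4) := by
            refine Real.log_le_log (by positivity) ?_
            rw [div_le_iff₀ hδ]
            linarith
        _ = 4 * Real.log 2 := by rw [Real.log_pow]; norm_num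
        _ ≤ 3 := by linarith [Real.log_two_lt_d9]
    have h4 : 1 / ε ^ 2 * Real.log (1 / δ) ≤ 3 / 2 * (d / ε ^ 2) := by
      have h6 : 0 < 1 / ε ^ 2 := by positivity
      calc _ ≤ 1 / ε ^ 2 * (3 / 2 * d) := by gcongr; linarith
        _ = _ := by ring
    have h5 : d * Real.log (1 / δ) ≤ d / ε ^ 2 := by
      rw [div_eq_mul_one_div (d : ℝ)]
      refine mul_le_mul_of_nonneg_left (hl.trans ?_) (Nat.cast_nonneg d)
      rw [le_div_iff₀ (by positivity)]
      nlinarith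
    linarith
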